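/- For a nonzero polynomial $P\in\mathbb{C}[x_1,\dots,x_n]$ let $$\mathrm{m}(P)=\frac{1}{(2\pi i)^n}\int_{\mathbb{T}^n}\log|P(x_1,\dots,x_n)|\,\frac{dx_1}{x_1}\cdots\frac{dx_n}{x_n},\qquad \mathbb{T}^n=\{(x_1,\dots,x_n)\in\mathbb{C}^n:|x_1|=\cdots=|x_n|=1\},$$ denote its (logarithmic) Mahler measure. For real $\alpha$ put $$P_\alpha(x,y)=(x+1)(y+1)(x+y)-\alpha xy,\qquad S_\alpha(x,y)=y^2+(x^4+\alpha x^3+2\alpha x^2+\alpha x+1)\,y+x^4.$$ Then, for every real $\alpha$, the integrals defining $\mathrm{m}(P_\alpha)$ and $\mathrm{m}(S_\alpha)$ converge absolutely, and $$\mathrm{m}(S_\alpha)=\begin{cases}2\,\mathrm{m}(P_\alpha) & \text{if } 0\le\alpha\le 4,\\ \mathrm{m}(P_\alpha) & \text{if } \alpha\le -1.\end{cases}$$ -/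

import Mathlib

namespace MahlerFamilies

open MvPolynomial

/-- The logarithmic Mahler measure
`m(P) = (2πi)⁻ⁿ ∫_{𝕋ⁿ} log |P(x₁, …, xₙ)| dx₁/x₁ ⋯ dxₙ/xₙ`
of a nonzero polynomial in `n` complex variables, written in the angular coordinates
`xⱼ = exp (i θⱼ)`, `0 ≤ θⱼ ≤ 2π`. (It is the contour integral on the unit torus by
`logMahler_eq_torusIntegral` below.) -/
noncomputable def logMahler {n : ℕ} (P : MvPolynomial (Fin n) ℂ) : ℝ :=
  ((2 * Real.pi) ^ n)⁻¹ *
    ∫ θ : Fin n → ℝ in Set.Icc (0 : Fin n → ℝ) (fun _ => 2 * Real.pi),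
      Real.log ‖eval (torusMap 0 1 θ) P‖

/-- The integral that defines the Mahler measure of `P` converges absolutely: `log |P|` is
integrable on the unit torus. -/
def LogIntegrable {n : ℕ} (P : MvPolynomial (Fin n) ℂ) : Prop :=
  TorusIntegrable (fun z : Fin n → ℂ => Real.log ‖eval z P‖) 0 1

/-- `logMahler` is the normalised contour integral of `log |P|` over the unit torus against
`dx₁/x₁ ⋯ dxₙ/xₙ`. -/
theorem logMahler_eq_torusIntegral {n : ℕ} (P : MvPolynomial (Fin n) ℂ) :
    (logMahler P : ℂ) = ((2 * Real.pi * Complex.I) ^ n)⁻¹ *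
      torusIntegral (fun z : Fin n → ℂ => (∏ i, z i)⁻¹ * (Real.log ‖eval z P‖ : ℂ)) 0 1 := by
  have h : ∀ θ : Fin n → ℝ,
      (∏ i, (((1 : Fin n → ℝ) i : ℝ) : ℂ) * Complex.exp (θ i * Complex.I) * Complex.I) •
        ((∏ i, torusMap 0 1 θ i)⁻¹ * (Real.log ‖eval (torusMap 0 1 θ) P‖ : ℂ))
      = Complex.I ^ n * (Real.log ‖eval (torusMap 0 1 θ) P‖ : ℂ) := by
    intro θ
    have h0 : (∏ i, Complex.exp (θ i * Complex.I)) ≠ 0 :=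
      Finset.prod_ne_zero_iff.mpr fun i _ => Complex.exp_ne_zero _
    simp only [smul_eq_mul, torusMap, Pi.one_apply, Pi.zero_apply, Complex.ofReal_one, one_mul,
      zero_add, Finset.prod_mul_distrib, Finset.prod_const, Finset.card_univ, Fintype.card_fin]
    rw [mul_comm _ (Complex.I ^ n), mul_assoc, mul_inv_cancel_left₀ h0]
  unfold logMahler torusIntegral
  simp_rw [h]
  rw [MeasureTheory.integral_const_mul, integral_complex_ofReal, mul_pow _ Complex.I]
  have hI : (Complex.I : ℂ) ^ n ≠ 0 := pow_ne_zero _ Complex.I_ne_zero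
  rw [mul_inv, mul_assoc, inv_mul_cancel_left₀ hI]
  push_cast
  rfl

/-- `P_α(x, y) = (x + 1)(y + 1)(x + y) - α x y`, with `x = X 0` and `y = X 1`. -/
noncomputable def polyP (α : ℝ) : MvPolynomial (Fin 2) ℂ :=
  (X 0 + 1) * (X 1 + 1) * (X 0 + X 1) - C (α : ℂ) * X 0 * X 1

/-- `S_α(x, y) = y² + (x⁴ + α x³ + 2 α x² + α x + 1) y + x⁴`, with `x = X 0` and `y = X 1`. -/
noncomputable def polyS (α : ℝ) : MvPolynomial (Fin 2) ℂ :=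
  X 1 ^ 2 + (X 0 ^ 4 + C (α : ℂ) * X 0 ^ 3 + 2 * C (α : ℂ) * X 0 ^ 2 + C (α : ℂ) * X 0 + 1) * X 1
    + X 0 ^ 4

end MahlerFamilies

namespace MahlerFamilies

open MeasureTheory Set

/-! On |x| = 1 put s = |x + 1|². As a polynomial in y, each of the two is, up to a rotation of y and
a factor a(x) with ∫ log |a| = 0, of the form y² + B y + 1 with B real. For `polyS`, B = (s - 2)² -
2 + sα; for `polyP`, B = -√s + α/√s up to sign. Jensen's formula in y and Fubini turn both Mahler
measures into circle averages of `quadLog B` (`logMahler_of_quadratic`).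

Since B is affine in α, and `quadLog` has derivative 1/√(B² - 4) for B > 2 and vanishes for |B| ≤ 2,
the α-derivatives are real elliptic integrals, `kernelS` and `kernelP`. The degree-two substitution
`landen` carries one differential to the other (`landen_differential`). It covers the relevant range
twice if 0 < β < 4 and once if β < -1, so `kernelS` is 2 `kernelP` in the first case and `kernelP`
in the second.

It remains to integrate back. At α = 0 all |B| ≤ 2, so both measures vanish and the factor 2
survives on [0, 4]. For α ≤ -1 the difference of the measures is constant, and it is 0 because both
are log |α| + o(1) along α = -1 - n.

The comparison is done with lower integrals in `ENNReal`, where Tonelli needs only measurability;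
finiteness comes from the integrability of `quadLog B`. -/

/-! ### The one-variable Mahler measure of y² + B y + 1. -/

/-- The logarithmic Mahler measure of `y² + B y + 1` for a real number `B`. -/
noncomputable def quadLog (B : ℝ) : ℝ := Real.arcosh (max 1 (|B| / 2))

theorem quadLog_nonneg (B : ℝ) : 0 ≤ quadLog B := Real.arcosh_nonneg (le_max_left _ _)

theorem quadLog_neg (B : ℝ) : quadLog (-B) = quadLog B := by simp [quadLog]

theorem continuous_quadLog : Continuous quadLog :=
  Real.continuousOn_arcosh.comp_continuous (by fun_prop)
    fun _ => mem_Ici.mpr (le_max_left _ _)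

theorem quadLog_of_abs_le {B : ℝ} (h : |B| ≤ 2) : quadLog B = 0 := by
  rw [quadLog, max_eq_left (by linarith), Real.arcosh_zero]

theorem quadLog_of_two_le {B : ℝ} (h : 2 ≤ B) : quadLog B = Real.arcosh (B / 2) := by
  rw [quadLog, abs_of_nonneg (by linarith), max_eq_right (by linarith)]

open Polynomial in
theorem logMahlerMeasure_quadratic {u : ℂ} (hu : ‖u‖ = 1) (B : ℝ) :
    (X ^ 2 + C (u * B) * X + C (u ^ 2)).logMahlerMeasure = quadLog B := by
  -- The factor u only rotates the roots. They are exp(±iφ) if |B| ≤ 2, and -sgn(B) exp(±l) with 2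
  -- cosh l = |B| otherwise.
  have key : ∀ v w : ℂ, v * w = 1 → v + w = -B →
      (X ^ 2 + C (u * B) * X + C (u ^ 2)).logMahlerMeasure = Real.posLog ‖v‖ + Real.posLog ‖w‖ := by
    intro v w h1 h2
    have hf : (X ^ 2 + C (u * B) * X + C (u ^ 2)) = (X - C (u * v)) * (X - C (u * w)) := by
      have e1 : u * B = -(u * v + u * w) := by linear_combination u * h2
      have e2 : u ^ 2 = (u * v) * (u * w) := by linear_combination (-u ^ 2) * h1
      rw [e1, e2]
      simp only [map_neg, map_add, map_mul]
      ring
    rw [hf, logMahlerMeasure_mul_eq_add_logMahlerMeasure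
      (mul_ne_zero (X_sub_C_ne_zero _) (X_sub_C_ne_zero _))]
    rw [logMahlerMeasure_X_sub_C, logMahlerMeasure_X_sub_C, norm_mul, norm_mul, hu, one_mul, one_mul]
  rcases le_total |B| 2 with h | h
  · rw [quadLog_of_abs_le h]
    have hcos : Real.cos (Real.arccos (-B / 2)) = -B / 2 :=
      Real.cos_arccos (by linarith [(abs_le.mp h).2]) (by linarith [(abs_le.mp h).1])
    set φ := Real.arccos (-B / 2)
    rw [key (Complex.exp (φ * Complex.I)) (Complex.exp ((-φ : ℝ) * Complex.I))]
    · simp only [Complex.norm_exp_ofReal_mul_I]; simp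
    · rw [← Complex.exp_add]; simp
    · have h2 := Complex.two_cos (φ : ℂ)
      rw [← Complex.ofReal_cos, hcos] at h2
      push_cast at h2 ⊢
      rw [← h2]; ring
  · have hq : Real.cosh (quadLog B) = |B| / 2 := by
      rw [quadLog, Real.cosh_arcosh (le_max_left _ _), max_eq_right (by linarith)]
    have hq0 := quadLog_nonneg B
    set l := quadLog B
    have hc : Real.exp l + Real.exp (-l) = |B| := by
      rw [Real.cosh_eq] at hq; linarith
    have hm : Real.exp l * Real.exp (-l) = 1 := by rw [← Real.exp_add]; simp
    obtain ⟨σ, hσ, hσB⟩ : ∃ σ : ℝ, |σ| = 1 ∧ σ * |B| = -B := by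
      rcases le_total 0 B with hB | hB
      · exact ⟨-1, by simp, by rw [abs_of_nonneg hB]; ring⟩
      · exact ⟨1, by simp, by rw [abs_of_nonpos hB]; ring⟩
    have hσ2 : σ * σ = 1 := by rw [← abs_mul_abs_self, hσ]; norm_num
    rw [key ((σ * Real.exp l : ℝ) : ℂ) ((σ * Real.exp (-l) : ℝ) : ℂ)]
    · simp only [Complex.norm_real, Real.norm_eq_abs, abs_mul, hσ, Real.abs_exp, one_mul]
      change max 0 (Real.log _) + max 0 (Real.log _) = l
      rw [Real.log_exp, Real.log_exp, max_eq_right hq0,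
        max_eq_left (by linarith), add_zero]
    · rw [← Complex.ofReal_mul, ← Complex.ofReal_one]
      congr 1
      linear_combination σ * σ * hm + hσ2
    · rw [← Complex.ofReal_add, ← Complex.ofReal_neg]
      congr 1
      linear_combination σ * hc + hσB

/-! ### Growth of `quadLog` along affine families B = p + q t. -/

theorem hasDerivAt_quadLog {B : ℝ} (h : 2 < B) :
    HasDerivAt quadLog (√(B ^ 2 - 4))⁻¹ B := by
  have h1 : HasDerivAt (fun x : ℝ => Real.arcosh (x / 2)) ((√((B / 2) ^ 2 - 1))⁻¹ * (1 / 2)) B :=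
    HasDerivAt.comp (h₂ := Real.arcosh) (h := fun x => x / 2) B
      (Real.hasDerivAt_arcosh (mem_Ioi.mpr (by linarith))) ((hasDerivAt_id B).div_const 2)
  have h2 : (√((B / 2) ^ 2 - 1))⁻¹ * (1 / 2) = (√(B ^ 2 - 4))⁻¹ := by
    have : B ^ 2 - 4 = 2 ^ 2 * ((B / 2) ^ 2 - 1) := by ring
    rw [this, Real.sqrt_mul (by norm_num), Real.sqrt_sq (by norm_num), mul_inv]
    ring
  rw [← h2]
  refine h1.congr_of_eventuallyEq ?_
  filter_upwards [eventually_gt_nhds h] with x hx using quadLog_of_two_le hx.le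

theorem lintegral_quadLog_kernel {p q a b : ℝ} (hq : 0 < q) (hab : a ≤ b) (ha : 2 ≤ p + q * a) :
    ENNReal.ofReal (quadLog (p + q * b)) = ENNReal.ofReal (quadLog (p + q * a)) +
      ∫⁻ t in Ioc a b, ENNReal.ofReal (q / √((p + q * t) ^ 2 - 4)) := by
  have hc : ContinuousOn (fun t => quadLog (p + q * t)) (Icc a b) :=
    (continuous_quadLog.comp (by fun_prop)).continuousOn
  have hd : ∀ t ∈ Ioo a b, HasDerivAt (fun t => quadLog (p + q * t))
      (q / √((p + q * t) ^ 2 - 4)) t := by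
    intro t ht
    have h2 : 2 < p + q * t := by nlinarith [ht.1]
    have h3 : HasDerivAt (fun t => p + q * t) q t := by
      simpa using ((hasDerivAt_id t).const_mul q).const_add p
    have := HasDerivAt.comp (h := fun t => p + q * t) t (hasDerivAt_quadLog h2) h3
    rwa [inv_mul_eq_div] at this
  -- If p + q a = 2 the kernel is unbounded near a; its sign alone gives integrability.
  have hi := intervalIntegral.integrableOn_deriv_of_nonneg hc hd fun t _ => by positivity
  have hF := intervalIntegral.integral_eq_sub_of_hasDerivAt_of_le hab hc hd
    ((intervalIntegrable_iff_integrableOn_Ioc_of_le hab).mpr hi)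
  rw [intervalIntegral.integral_of_le hab] at hF
  rw [← ofReal_integral_eq_lintegral_ofReal hi (Filter.Eventually.of_forall fun t => by positivity),
    ← ENNReal.ofReal_add (quadLog_nonneg _)
      (integral_nonneg fun t => by positivity), hF]
  congr 1
  ring

/-- The bound -2 ≤ p keeps B away from B < -2, where `quadLog` decreases. While |B| ≤ 2 the kernel
is 0 by the conventions for square roots of nonpositive numbers and division by 0. -/
theorem quadLog_affine {p q τ : ℝ} (hp : -2 ≤ p) (hq : 0 < q) (hτ : 0 ≤ τ) :
    ENNReal.ofReal (quadLog (p + q * τ)) = ENNReal.ofReal (quadLog p) +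
      ∫⁻ t in Ioc 0 τ, ENNReal.ofReal (q / √((p + q * t) ^ 2 - 4)) := by
  -- The time at which B reaches 2, clamped to [0, τ].
  set c := min τ (max 0 ((2 - p) / q)) with hcdef
  have hc0 : 0 ≤ c := le_min hτ (le_max_left _ _)
  have hcτ : c ≤ τ := min_le_left _ _
  have hc : 0 < c → p + q * c ≤ 2 := by
    intro h
    have h1 : c ≤ (2 - p) / q := by
      rcases le_max_iff.mp (min_le_right τ (max 0 ((2 - p) / q))) with h' | h'
      · exact absurd h (not_lt.mpr h')
      · exact h'
    rw [le_div_iff₀ hq] at h1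
    linarith
  have h1 : ∫⁻ t in Ioc 0 c, ENNReal.ofReal (q / √((p + q * t) ^ 2 - 4)) = 0 := by
    rw [setLIntegral_congr_fun (g := fun _ => 0) measurableSet_Ioc, lintegral_zero]
    intro t ht
    have hle := hc (ht.1.trans_le ht.2)
    have hqt : q * t ≤ q * c := mul_le_mul_of_nonneg_left ht.2 hq.le
    have hqt0 : 0 < q * t := mul_pos hq ht.1
    have : (p + q * t) ^ 2 - 4 ≤ 0 := by nlinarith
    simp [Real.sqrt_eq_zero_of_nonpos this]
  have h2 : quadLog (p + q * c) = quadLog p := by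
    rcases hc0.eq_or_lt with h | h
    · rw [← h]; simp
    · have := hc h
      have hqc := mul_pos hq h
      rw [quadLog_of_abs_le, quadLog_of_abs_le] <;> rw [abs_le] <;> constructor <;> linarith
  rw [← Ioc_union_Ioc_eq_Ioc hc0 hcτ, lintegral_union measurableSet_Ioc
    (Ioc_disjoint_Ioc_of_le le_rfl), h1, zero_add]
  rcases hcτ.eq_or_lt with h | h
  · rw [h] at h2 ⊢
    simp [h2]
  · rw [lintegral_quadLog_kernel hq hcτ, h2]
    have h3 : (2 - p) / q ≤ c := by
      rw [hcdef] at h ⊢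
      rw [min_eq_right (by
        by_contra h'
        rw [min_eq_left (not_le.mp h').le] at h
        exact lt_irrefl _ h)]
      exact le_max_right _ _
    rw [div_le_iff₀ hq] at h3
    linarith

/-! ### Monotone changes of variable and integration in the parameter. -/

/-- The derivative is constrained only on the open interval, because it vanishes at endpoints in the
applications: at the critical point of `landen`, and at multiples of π for 2 + 2 cos θ. -/
theorem lintegral_comp_of_deriv_pos {f f' : ℝ → ℝ} {a b : ℝ} (hab : a ≤ b)
    (hc : ContinuousOn f (Icc a b)) (hd : ∀ x ∈ Ioo a b, HasDerivAt f (f' x) x)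
    (hpos : ∀ x ∈ Ioo a b, 0 < f' x) (g : ℝ → ENNReal) :
    ∫⁻ x in Ioo (f a) (f b), g x = ∫⁻ x in Ioo a b, ENNReal.ofReal (f' x) * g (f x) := by
  have hmono : StrictMonoOn f (Icc a b) := by
    refine strictMonoOn_of_deriv_pos (convex_Icc a b) hc fun x hx => ?_
    rw [interior_Icc] at hx
    rw [(hd x hx).deriv]
    exact hpos x hx
  have himg : f '' Ioo a b = Ioo (f a) (f b) := by
    refine Subset.antisymm ?_ (intermediate_value_Ioo hab hc)
    rintro _ ⟨x, hx, rfl⟩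
    exact ⟨hmono (left_mem_Icc.mpr hab) (Ioo_subset_Icc_self hx) hx.1,
      hmono (Ioo_subset_Icc_self hx) (right_mem_Icc.mpr hab) hx.2⟩
  rw [← himg]
  exact lintegral_image_eq_lintegral_deriv_mul_of_monotoneOn measurableSet_Ioo
    (fun x hx => (hd x hx).hasDerivWithinAt) (hmono.monotoneOn.mono Ioo_subset_Icc_self) g

theorem lintegral_comp_of_deriv_neg {f f' : ℝ → ℝ} {a b : ℝ} (hab : a ≤ b)
    (hc : ContinuousOn f (Icc a b)) (hd : ∀ x ∈ Ioo a b, HasDerivAt f (f' x) x)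
    (hneg : ∀ x ∈ Ioo a b, f' x < 0) (g : ℝ → ENNReal) :
    ∫⁻ x in Ioo (f b) (f a), g x = ∫⁻ x in Ioo a b, ENNReal.ofReal (-f' x) * g (f x) := by
  have hmono : StrictAntiOn f (Icc a b) := by
    refine strictAntiOn_of_deriv_neg (convex_Icc a b) hc fun x hx => ?_
    rw [interior_Icc] at hx
    rw [(hd x hx).deriv]
    exact hneg x hx
  have himg : f '' Ioo a b = Ioo (f b) (f a) := by
    refine Subset.antisymm ?_ (intermediate_value_Ioo' hab hc)
    rintro _ ⟨x, hx, rfl⟩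
    exact ⟨hmono (Ioo_subset_Icc_self hx) (right_mem_Icc.mpr hab) hx.2,
      hmono (left_mem_Icc.mpr hab) (Ioo_subset_Icc_self hx) hx.1⟩
  rw [← himg]
  exact lintegral_image_eq_lintegral_deriv_mul_of_antitoneOn measurableSet_Ioo
    (fun x hx => (hd x hx).hasDerivWithinAt) (hmono.antitoneOn.mono Ioo_subset_Icc_self) g

/-- The density of `2 + 2 cos θ`, up to normalisation. -/
noncomputable def arcsineWeight (s : ℝ) : ENNReal := ENNReal.ofReal (1 / √(s * (4 - s)))

theorem measurable_arcsineWeight : Measurable arcsineWeight := by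
  unfold arcsineWeight; fun_prop

theorem lintegral_quadLog_affine {p q : ℝ → ℝ} (hpm : Measurable p) (hqm : Measurable q)
    (hp : ∀ s ∈ Ioo (0 : ℝ) 4, -2 ≤ p s) (hq : ∀ s ∈ Ioo (0 : ℝ) 4, 0 < q s) {τ : ℝ}
    (hτ : 0 ≤ τ) :
    ∫⁻ s in Ioo (0 : ℝ) 4, ENNReal.ofReal (quadLog (p s + q s * τ)) * arcsineWeight s =
      (∫⁻ s in Ioo (0 : ℝ) 4, ENNReal.ofReal (quadLog (p s)) * arcsineWeight s) +
      ∫⁻ t in Ioc 0 τ, ∫⁻ s in Ioo (0 : ℝ) 4,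
        ENNReal.ofReal (q s / √((p s + q s * t) ^ 2 - 4)) * arcsineWeight s := by
  have hw := measurable_arcsineWeight
  have hl := continuous_quadLog.measurable
  have hk : Measurable (Function.uncurry fun (t s : ℝ) =>
      ENNReal.ofReal (q s / √((p s + q s * t) ^ 2 - 4)) * arcsineWeight s) := by
    unfold Function.uncurry
    fun_prop
  rw [lintegral_lintegral_swap hk.aemeasurable, ← lintegral_add_left (by fun_prop)]
  refine setLIntegral_congr_fun measurableSet_Ioo fun s hs => ?_
  rw [quadLog_affine (hp s hs) (hq s hs) hτ, add_mul, lintegral_mul_const _ (by fun_prop)]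

theorem setLIntegral_Ioo_eq_of_eq_zero {g : ℝ → ENNReal} {a b c : ℝ} (hab : a < b) (hbc : b ≤ c)
    (h : ∀ x ∈ Ico b c, g x = 0) : ∫⁻ x in Ioo a c, g x = ∫⁻ x in Ioo a b, g x := by
  rw [← Ioo_union_Ico_eq_Ioo hab hbc, lintegral_union measurableSet_Ico
    (disjoint_left.mpr fun x h1 h2 => not_lt.mpr h2.1 h1.2),
    setLIntegral_congr_fun measurableSet_Ico h, lintegral_zero, add_zero]

/-! ### The two elliptic integrals and the substitution between them. -/

/-- The derivative in `β` of the Mahler measure of `S_β`, up to normalisation. -/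
noncomputable def kernelS (β : ℝ) : ENNReal := ∫⁻ s in Ioo (0 : ℝ) 4,
  ENNReal.ofReal (s / √(((s - 2) ^ 2 - 2 + s * β) ^ 2 - 4)) * arcsineWeight s

/-- The derivative in `β` of the Mahler measure of `P_β`, up to normalisation. -/
noncomputable def kernelP (β : ℝ) : ENNReal := ∫⁻ s in Ioo (0 : ℝ) 4,
  ENNReal.ofReal ((√s)⁻¹ / √((-√s + (√s)⁻¹ * β) ^ 2 - 4)) * arcsineWeight s

theorem kernelP_eq (β : ℝ) : kernelP β = ∫⁻ s in Ioo (0 : ℝ) 4,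
    ENNReal.ofReal (1 / √(s * (4 - s) * ((s - β) ^ 2 - 4 * s))) := by
  refine setLIntegral_congr_fun measurableSet_Ioo fun s hs => ?_
  have hs0 : 0 < √s := Real.sqrt_pos.mpr hs.1
  have hss : √s ^ 2 = s := Real.sq_sqrt hs.1.le
  have h1 : (s - β) ^ 2 - 4 * s = s * ((-√s + (√s)⁻¹ * β) ^ 2 - 4) := by
    nth_rw 1 2 3 [← hss]
    field_simp
    ring
  have h2 : √(s * (4 - s) * ((s - β) ^ 2 - 4 * s)) =
      √(s * (4 - s)) * (√s * √((-√s + (√s)⁻¹ * β) ^ 2 - 4)) := by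
    rw [Real.sqrt_mul (mul_nonneg hs.1.le (by linarith [hs.2])), h1,
      Real.sqrt_mul hs.1.le (_ - 4)]
  simp only [arcsineWeight]
  rw [← ENNReal.ofReal_mul (by positivity), h2]
  congr 1
  simp only [div_eq_mul_inv, mul_inv]
  ring

/-- With r = 4 - s the factor 4 - r of B² - 4 and that of the weight combine to cancel the numerator
s = 4 - r. -/
theorem kernelS_eq (β : ℝ) : kernelS β = ∫⁻ r in Ioo (0 : ℝ) 4,
    ENNReal.ofReal (1 / √(r * (β - r) * (r ^ 2 - (4 + β) * r + 4 + 4 * β))) := by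
  have h := lintegral_comp_of_deriv_neg (f := fun r : ℝ => 4 - r) (f' := fun _ => -1)
    (a := 0) (b := 4) (by norm_num) (by fun_prop)
    (fun x _ => by simpa using (hasDerivAt_id x).const_sub 4) (by simp)
    (fun s => ENNReal.ofReal (s / √(((s - 2) ^ 2 - 2 + s * β) ^ 2 - 4)) * arcsineWeight s)
  rw [sub_self, sub_zero] at h
  rw [kernelS, h]
  refine setLIntegral_congr_fun measurableSet_Ioo fun r hr => ?_
  have hs : 0 < 4 - r := by linarith [hr.2]
  have h1 : ((4 - r - 2) ^ 2 - 2 + (4 - r) * β) ^ 2 - 4 =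
      (4 - r) * ((β - r) * (r ^ 2 - (4 + β) * r + 4 + 4 * β)) := by ring
  simp only [arcsineWeight, neg_neg, ENNReal.ofReal_one, one_mul]
  rw [← ENNReal.ofReal_mul (by positivity), h1, Real.sqrt_mul hs.le, Real.sqrt_mul hs.le,
    mul_assoc r, Real.sqrt_mul hr.1.le, sub_sub_cancel]
  congr 1
  have h2 : 4 - r = √(4 - r) * √(4 - r) := (Real.mul_self_sqrt hs.le).symm
  have h3 : √(4 - r) ≠ 0 := (Real.sqrt_pos.mpr hs).ne'
  nth_rw 1 [h2]
  field_simp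

/-- The substitution that relates the two elliptic differentials. -/
noncomputable def landen (β r : ℝ) : ℝ := r * (β - r) / (1 + β - r)

theorem hasDerivAt_landen {β r : ℝ} (h : 1 + β - r ≠ 0) : HasDerivAt (landen β)
    ((r ^ 2 - 2 * (1 + β) * r + β * (1 + β)) / (1 + β - r) ^ 2) r := by
  have h1 : HasDerivAt (fun r : ℝ => r * (β - r)) (1 * (β - r) + r * (-1)) r :=
    (hasDerivAt_id r).mul ((hasDerivAt_id r).const_sub β)
  have h2 : HasDerivAt (fun r : ℝ => 1 + β - r) (-1) r := (hasDerivAt_id r).const_sub (1 + β)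
  refine (h1.div h2 h).congr_deriv ?_
  congr 1
  ring

/-- The radicand of `kernelP` at `landen β r` is the square of the derivative of `landen β` times
the radicand of `kernelS` at r. With √ equal to 0 on negatives, no sign condition on the radicands
is needed. -/
theorem landen_differential {β r : ℝ} (hA : 1 + β - r ≠ 0)
    (hM : r ^ 2 - 2 * (1 + β) * r + β * (1 + β) ≠ 0) :
    |r ^ 2 - 2 * (1 + β) * r + β * (1 + β)| / (1 + β - r) ^ 2 *
      (1 / √(landen β r * (4 - landen β r) * ((landen β r - β) ^ 2 - 4 * landen β r))) =
    1 / √(r * (β - r) * (r ^ 2 - (4 + β) * r + 4 + 4 * β)) := by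
  set M := r ^ 2 - 2 * (1 + β) * r + β * (1 + β) with hMdef
  have h1 : landen β r * (4 - landen β r) * ((landen β r - β) ^ 2 - 4 * landen β r) =
      (M / (1 + β - r) ^ 2) ^ 2 * (r * (β - r) * (r ^ 2 - (4 + β) * r + 4 + 4 * β)) := by
    rw [div_pow, hMdef, landen]
    field_simp
    ring
  rw [h1, Real.sqrt_mul (sq_nonneg _), Real.sqrt_sq_eq_abs, abs_div, abs_pow, sq_abs]
  have : |M| ≠ 0 := abs_ne_zero.mpr hM
  simp only [one_div, mul_inv, inv_div]
  field_simp

/-- `landen β` rises from 0 on (0, r₀) and falls back to 0 on (r₀, β), so each half of (0, β)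
contributes one copy of `kernelP`. The condition β < 4 keeps (0, β) inside the domain (0, 4). -/
theorem kernelS_eq_two_mul_kernelP {β : ℝ} (h0 : 0 < β) (h4 : β < 4) :
    kernelS β = 2 * kernelP β := by
  set a := √(1 + β) with ha
  have ha2 : a ^ 2 = 1 + β := Real.sq_sqrt (by linarith)
  have ha1 : 1 < a := by
    rw [ha, Real.lt_sqrt (by norm_num)]; linarith
  have ha3 : a < 3 := by nlinarith
  have hβ : β = a ^ 2 - 1 := by linarith
  -- The smaller critical point of `landen β`. Its critical value (a - 1)² is the smaller root of (s
  -- - β)² - 4s, past which the integrand of `kernelP` is 0 on (0, 4).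
  set r₀ := a * (a - 1) with hr₀
  have hr₀0 : 0 < r₀ := mul_pos (by linarith) (by linarith)
  have hr₀β : r₀ < β := by rw [hβ, hr₀]; nlinarith
  have hA : ∀ r, r ≤ β → 1 + β - r ≠ 0 := fun r hr => by linarith
  have hfac : ∀ r, r ^ 2 - 2 * (1 + β) * r + β * (1 + β) = (r₀ - r) * (a * (a + 1) - r) := by
    intro r; rw [hβ, hr₀]; ring
  have hpos : ∀ r, r ≤ β → 0 < a * (a + 1) - r := fun r hr => by rw [hβ] at hr; nlinarith
  have hcont : ContinuousOn (landen β) (Iic β) := fun r hr =>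
    (hasDerivAt_landen (hA r hr)).continuousAt.continuousWithinAt
  have hl0 : landen β 0 = 0 := by simp [landen]
  have hlβ : landen β β = 0 := by simp [landen]
  have hlr : landen β r₀ = (a - 1) ^ 2 := by
    have : 1 + β - r₀ = a := by rw [hβ, hr₀]; ring
    rw [landen, this, hβ, hr₀]
    field_simp
    ring
  set H : ℝ → ENNReal := fun s => ENNReal.ofReal (1 / √(s * (4 - s) * ((s - β) ^ 2 - 4 * s)))
  have hP : kernelP β = ∫⁻ s in Ioo 0 ((a - 1) ^ 2), H s := by
    rw [kernelP_eq]
    refine setLIntegral_Ioo_eq_of_eq_zero (by nlinarith) (by nlinarith) fun s hs => ?_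
    have h1 : (s - β) ^ 2 - 4 * s = (s - (a - 1) ^ 2) * (s - (a + 1) ^ 2) := by rw [hβ]; ring
    have h2 : s * (4 - s) * ((s - β) ^ 2 - 4 * s) ≤ 0 := by
      rw [h1]
      have h3 : (a - 1) ^ 2 ≤ s := hs.1
      have h4 : s < 4 := hs.2
      exact mul_nonpos_of_nonneg_of_nonpos
        (mul_nonneg ((sq_nonneg _).trans h3) (by linarith))
        (mul_nonpos_of_nonneg_of_nonpos (by linarith) (by nlinarith))
    simp [Real.sqrt_eq_zero_of_nonpos h2]
  have hleft := lintegral_comp_of_deriv_pos hr₀0.le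
    (hcont.mono fun r hr => hr.2.trans hr₀β.le)
    (fun r hr => hasDerivAt_landen (hA r (hr.2.trans hr₀β).le))
    (fun r hr => by
      rw [hfac]
      exact div_pos (mul_pos (by linarith [hr.2]) (hpos r (hr.2.trans hr₀β).le))
        (pow_pos (by linarith [hr.2]) 2)) H
  have hright := lintegral_comp_of_deriv_neg hr₀β.le
    (hcont.mono fun r hr => hr.2)
    (fun r hr => hasDerivAt_landen (hA r hr.2.le))
    (fun r hr => by
      rw [hfac]
      exact div_neg_of_neg_of_pos (mul_neg_of_neg_of_pos (by linarith [hr.1]) (hpos r hr.2.le))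
        (pow_pos (by linarith [hr.2]) 2)) H
  rw [hl0, hlr, ← hP] at hleft
  rw [hlβ, hlr, ← hP] at hright
  set G : ℝ → ENNReal := fun r =>
    ENNReal.ofReal (1 / √(r * (β - r) * (r ^ 2 - (4 + β) * r + 4 + 4 * β))) with hG
  have hleft' : kernelP β = ∫⁻ r in Ioo 0 r₀, G r := by
    refine hleft.trans (setLIntegral_congr_fun measurableSet_Ioo fun r hr => ?_)
    have hM : 0 < r ^ 2 - 2 * (1 + β) * r + β * (1 + β) := by
      rw [hfac]; exact mul_pos (by linarith [hr.2]) (hpos r (hr.2.trans hr₀β).le)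
    simp only [H, hG]
    rw [← ENNReal.ofReal_mul (by positivity),
      ← landen_differential (hA r (hr.2.trans hr₀β).le) hM.ne', abs_of_pos hM]
  have hright' : kernelP β = ∫⁻ r in Ioo r₀ β, G r := by
    refine hright.trans (setLIntegral_congr_fun measurableSet_Ioo fun r hr => ?_)
    have hM : r ^ 2 - 2 * (1 + β) * r + β * (1 + β) < 0 := by
      rw [hfac]; exact mul_neg_of_neg_of_pos (by linarith [hr.1]) (hpos r hr.2.le)
    simp only [H, hG]
    rw [← landen_differential (hA r hr.2.le) hM.ne, abs_of_neg hM, neg_div,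
      ENNReal.ofReal_mul (by rw [← neg_div]; exact div_nonneg (by linarith) (sq_nonneg _))]
  have hzero : ∀ r ∈ Ico β 4, G r = 0 := by
    intro r hr
    have hD : 0 < r ^ 2 - (4 + β) * r + 4 + 4 * β := by nlinarith [sq_nonneg (2 * r - (4 + β))]
    have : r * (β - r) * (r ^ 2 - (4 + β) * r + 4 + 4 * β) ≤ 0 :=
      mul_nonpos_of_nonpos_of_nonneg
        (mul_nonpos_of_nonneg_of_nonpos (h0.le.trans hr.1) (by linarith [hr.1])) hD.le
    simp [hG, Real.sqrt_eq_zero_of_nonpos this]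
  calc kernelS β = ∫⁻ r in Ioo 0 β, G r := by
        rw [kernelS_eq, setLIntegral_Ioo_eq_of_eq_zero h0 h4.le hzero]
    _ = (∫⁻ r in Ioo 0 r₀, G r) + ∫⁻ r in Ioo r₀ β, G r := by
        rw [← Ioo_union_Ico_eq_Ioo hr₀0 hr₀β.le, lintegral_union measurableSet_Ico
          (disjoint_left.mpr fun x h1 h2 => not_lt.mpr h2.1 h1.2),
          setLIntegral_congr (Ioo_ae_eq_Ico (a := r₀) (b := β))]
    _ = 2 * kernelP β := by rw [← hleft', ← hright', two_mul]

/-- Here `landen β` has no critical point in r ≥ 0 and maps (0, c) increasingly onto all of (0, 4).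
-/
theorem kernelS_eq_kernelP {β : ℝ} (h : β < -1) : kernelS β = kernelP β := by
  set ρ := √(β ^ 2 - 8 * β) with hρ
  have hρ2 : ρ ^ 2 = β ^ 2 - 8 * β := Real.sq_sqrt (by nlinarith)
  have hρ0 : 0 ≤ ρ := Real.sqrt_nonneg _
  have hρ1 : |4 + β| < ρ := abs_lt_of_sq_lt_sq (by nlinarith) hρ0
  have hρ3 : ρ < 4 - β := lt_of_pow_lt_pow_left₀ 2 (by linarith) (by nlinarith)
  obtain ⟨hρ4, hρ5⟩ := abs_lt.mp hρ1
  -- The positive root of r² - (4 + β) r + 4 + 4β, which is also the equation `landen β r = 4`.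
  set c := (4 + β + ρ) / 2 with hc
  have hc0 : 0 < c := by rw [hc]; linarith
  have hc4 : c < 4 := by rw [hc]; linarith
  have hD : ∀ r, r ^ 2 - (4 + β) * r + 4 + 4 * β = (r - c) * (r - (4 + β - ρ) / 2) := by
    intro r; rw [hc]; linear_combination (1 / 4) * hρ2
  have hA : ∀ r, 0 ≤ r → 1 + β - r ≠ 0 := fun r hr => by linarith
  have hM : ∀ r, 0 ≤ r → 0 < r ^ 2 - 2 * (1 + β) * r + β * (1 + β) := fun r hr => by
    nlinarith [mul_nonneg hr (show 0 ≤ -(1 + β) by linarith)]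
  have hl0 : landen β 0 = 0 := by simp [landen]
  have hlc : landen β c = 4 := by
    have := hD c
    rw [landen, div_eq_iff (hA c hc0.le)]
    linear_combination -this
  have key := lintegral_comp_of_deriv_pos hc0.le
    (fun r hr => (hasDerivAt_landen (hA r hr.1)).continuousAt.continuousWithinAt)
    (fun r hr => hasDerivAt_landen (hA r hr.1.le))
    (fun r hr => div_pos (hM r hr.1.le) (pow_two_pos_of_ne_zero (hA r hr.1.le)))
    (fun s => ENNReal.ofReal (1 / √(s * (4 - s) * ((s - β) ^ 2 - 4 * s))))
  rw [hl0, hlc, ← kernelP_eq] at key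
  rw [key, kernelS_eq, setLIntegral_Ioo_eq_of_eq_zero hc0 hc4.le]
  · refine setLIntegral_congr_fun measurableSet_Ioo fun r hr => ?_
    have hMr := hM r hr.1.le
    rw [← ENNReal.ofReal_mul (by positivity),
      ← landen_differential (hA r hr.1.le) hMr.ne', abs_of_pos hMr]
  · intro r hr
    have : r * (β - r) * (r ^ 2 - (4 + β) * r + 4 + 4 * β) ≤ 0 := by
      rw [hD]
      have hr0 : 0 ≤ r := hc0.le.trans hr.1
      exact mul_nonpos_of_nonpos_of_nonneg
        (mul_nonpos_of_nonneg_of_nonpos hr0 (by linarith))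
        (mul_nonneg (by linarith [hr.1]) (by linarith))
    simp [Real.sqrt_eq_zero_of_nonpos this]

/-! ### Jensen and Fubini on the torus. -/

theorem integral_log_quadratic {a u : ℂ} (ha : a ≠ 0) (hu : ‖u‖ = 1) (B : ℝ) :
    IntegrableOn (fun φ : ℝ => Real.log ‖a * (Complex.exp (φ * Complex.I) ^ 2 +
        u * B * Complex.exp (φ * Complex.I) + u ^ 2)‖) (Ioc 0 (2 * Real.pi)) ∧
      ∫ φ in Ioc 0 (2 * Real.pi), Real.log ‖a * (Complex.exp (φ * Complex.I) ^ 2 +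
        u * B * Complex.exp (φ * Complex.I) + u ^ 2)‖ =
      2 * Real.pi * (Real.log ‖a‖ + quadLog B) := by
  have hπ : (0 : ℝ) ≤ 2 * Real.pi := by positivity
  set q : Polynomial ℂ := Polynomial.X ^ 2 + Polynomial.C (u * B) * Polynomial.X +
    Polynomial.C (u ^ 2) with hq
  have hq0 : q ≠ 0 := fun h => by
    have := congrArg (Polynomial.eval 0) h
    simp [hq] at this
    simp [this] at hu
  have heq : ∀ φ : ℝ, a * (Complex.exp (φ * Complex.I) ^ 2 +
      u * B * Complex.exp (φ * Complex.I) + u ^ 2) =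
      (Polynomial.C a * q).eval (circleMap 0 1 φ) := by
    intro φ; simp [hq, circleMap]
  simp only [heq]
  have hm := Polynomial.logMahlerMeasure_C_mul ha hq0
  rw [hq, logMahlerMeasure_quadratic hu, ← hq, Polynomial.logMahlerMeasure_def,
    Real.circleAverage_def, intervalIntegral.integral_of_le hπ, smul_eq_mul,
    inv_mul_eq_iff_eq_mul₀ (by positivity)] at hm
  exact ⟨(intervalIntegrable_iff_integrableOn_Ioc_of_le hπ).mp
    (Polynomial.intervalIntegrable_mahlerMeasure _), hm⟩

theorem continuous_eval_torus (P : MvPolynomial (Fin 2) ℂ) :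
    Continuous fun z : ℝ × ℝ => MvPolynomial.eval
      ![Complex.exp (z.1 * Complex.I), Complex.exp (z.2 * Complex.I)] P := by
  refine (MvPolynomial.continuous_eval P).comp (continuous_pi fun i => ?_)
  fin_cases i <;> simp <;> fun_prop

theorem exists_eval_torus_le (P : MvPolynomial (Fin 2) ℂ) :
    ∃ M : ℝ, 0 ≤ M ∧ ∀ z ∈ Icc (0 : ℝ) (2 * Real.pi) ×ˢ Icc (0 : ℝ) (2 * Real.pi),
      Real.log ‖MvPolynomial.eval
        ![Complex.exp (z.1 * Complex.I), Complex.exp (z.2 * Complex.I)] P‖ ≤ M := by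
  obtain ⟨C, hC⟩ := (isCompact_Icc.prod isCompact_Icc).exists_bound_of_continuousOn
    (continuous_eval_torus P).continuousOn
  refine ⟨Real.log (max C 1), Real.log_nonneg (le_max_right _ _), fun z hz => ?_⟩
  rcases (norm_nonneg (MvPolynomial.eval
    ![Complex.exp (z.1 * Complex.I), Complex.exp (z.2 * Complex.I)] P)).eq_or_lt with h | h
  · rw [← h, Real.log_zero]; exact Real.log_nonneg (le_max_right _ _)
  · exact Real.log_le_log h ((hC z hz).trans (le_max_left _ _))

theorem torus_transfer (P : MvPolynomial (Fin 2) ℂ) :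
    (LogIntegrable P ↔ Integrable (fun z : ℝ × ℝ => Real.log ‖MvPolynomial.eval
        ![Complex.exp (z.1 * Complex.I), Complex.exp (z.2 * Complex.I)] P‖)
      ((volume.restrict (Ioc 0 (2 * Real.pi))).prod (volume.restrict (Ioc 0 (2 * Real.pi))))) ∧
    logMahler P = ((2 * Real.pi) ^ 2)⁻¹ * ∫ z : ℝ × ℝ, Real.log ‖MvPolynomial.eval
        ![Complex.exp (z.1 * Complex.I), Complex.exp (z.2 * Complex.I)] P‖
      ∂((volume.restrict (Ioc 0 (2 * Real.pi))).prod (volume.restrict (Ioc 0 (2 * Real.pi)))) := by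
  set F : ℝ × ℝ → ℝ := fun z => Real.log ‖MvPolynomial.eval
        ![Complex.exp (z.1 * Complex.I), Complex.exp (z.2 * Complex.I)] P‖ with hFdef
  have hF : ∀ θ : Fin 2 → ℝ, Real.log ‖MvPolynomial.eval (torusMap 0 1 θ) P‖ =
      F (MeasurableEquiv.finTwoArrow θ) := by
    intro θ
    have : torusMap 0 1 θ = ![Complex.exp (θ 0 * Complex.I), Complex.exp (θ 1 * Complex.I)] := by
      ext i; fin_cases i <;> simp [torusMap]
    rw [this]
    rfl
  have hS : Icc (0 : Fin 2 → ℝ) (fun _ => 2 * Real.pi) = MeasurableEquiv.finTwoArrow ⁻¹'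
      (Icc (0 : ℝ) (2 * Real.pi) ×ˢ Icc (0 : ℝ) (2 * Real.pi)) := by
    ext θ
    simp [MeasurableEquiv.finTwoArrow, Pi.le_def, Fin.forall_fin_two]
  have hμ : (volume.restrict (Icc (0 : ℝ) (2 * Real.pi) ×ˢ Icc (0 : ℝ) (2 * Real.pi)) :
      Measure (ℝ × ℝ)) =
      (volume.restrict (Ioc 0 (2 * Real.pi))).prod (volume.restrict (Ioc 0 (2 * Real.pi))) := by
    rw [Measure.volume_eq_prod, ← Measure.prod_restrict, restrict_Ioc_eq_restrict_Icc]
  have he := volume_preserving_finTwoArrow ℝ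
  constructor
  · rw [LogIntegrable, TorusIntegrable]
    simp only [hF]
    rw [hS, ← hμ]
    change IntegrableOn (F ∘ MeasurableEquiv.finTwoArrow) _ _ ↔ IntegrableOn F _ _
    exact he.integrableOn_comp_preimage MeasurableEquiv.finTwoArrow.measurableEmbedding
  · rw [logMahler]
    simp only [hF]
    rw [hS, ← hμ, he.setIntegral_preimage_emb MeasurableEquiv.finTwoArrow.measurableEmbedding]

theorem logMahler_of_quadratic {P : MvPolynomial (Fin 2) ℂ} {a u : ℝ → ℂ} {B : ℝ → ℝ}
    (hu : ∀ θ, ‖u θ‖ = 1)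
    (hP : ∀ᵐ θ : ℝ ∂volume.restrict (Ioc 0 (2 * Real.pi)), a θ ≠ 0 ∧
      ∀ y : ℂ, MvPolynomial.eval ![Complex.exp (θ * Complex.I), y] P =
        a θ * (y ^ 2 + u θ * B θ * y + u θ ^ 2))
    (hai : IntegrableOn (fun θ => Real.log ‖a θ‖) (Ioc 0 (2 * Real.pi)))
    (ha0 : ∫ θ in Ioc 0 (2 * Real.pi), Real.log ‖a θ‖ = 0) :
    LogIntegrable P ∧ IntegrableOn (fun θ => quadLog (B θ)) (Ioc 0 (2 * Real.pi)) ∧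
      logMahler P = (2 * Real.pi)⁻¹ * ∫ θ in Ioc 0 (2 * Real.pi), quadLog (B θ) := by
  set μ : Measure ℝ := volume.restrict (Ioc 0 (2 * Real.pi)) with hμ
  set F : ℝ × ℝ → ℝ := fun z => Real.log ‖MvPolynomial.eval
        ![Complex.exp (z.1 * Complex.I), Complex.exp (z.2 * Complex.I)] P‖ with hF
  have hπ : 0 < 2 * Real.pi := by positivity
  have hμ1 : μ.real univ = 2 * Real.pi := by simp [hμ, Measure.real, Real.pi_nonneg]
  have hsec : ∀ᵐ θ ∂μ, Integrable (fun φ => F (θ, φ)) μ ∧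
      ∫ φ, F (θ, φ) ∂μ = 2 * Real.pi * (Real.log ‖a θ‖ + quadLog (B θ)) := by
    filter_upwards [hP] with θ hθ
    have := integral_log_quadratic hθ.1 (hu θ) (B θ)
    simp only [← hθ.2] at this
    exact this
  have hFm : Measurable F :=
    Real.measurable_log.comp (continuous_eval_torus P).norm.measurable
  obtain ⟨M, hM0, hM⟩ := exists_eval_torus_le P
  have hmem : ∀ᵐ θ ∂μ, θ ∈ Ioc 0 (2 * Real.pi) := ae_restrict_mem measurableSet_Ioc
  have hFi : Integrable F (μ.prod μ) := by
    rw [integrable_prod_iff hFm.aestronglyMeasurable]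
    refine ⟨hsec.mono fun θ h => h.1, ?_⟩
    refine Integrable.mono' (g := fun θ => 2 * Real.pi * (2 * M - Real.log ‖a θ‖))
      (((integrable_const _).sub hai).const_mul _)
      (hFm.norm.stronglyMeasurable.integral_prod_right.aestronglyMeasurable) ?_
    filter_upwards [hsec, hmem] with θ hθ hθm
    rw [Real.norm_of_nonneg (integral_nonneg fun _ => norm_nonneg _)]
    -- Since F ≤ M and 0 ≤ M, |F| ≤ 2M - F; the integral of F over a section is known exactly.
    calc ∫ φ, ‖F (θ, φ)‖ ∂μ ≤ ∫ φ, (2 * M - F (θ, φ)) ∂μ := by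
          refine integral_mono_ae hθ.1.norm ((integrable_const _).sub hθ.1) ?_
          filter_upwards [hmem] with φ hφ
          have : F (θ, φ) ≤ M := hM (θ, φ) ⟨Ioc_subset_Icc_self hθm, Ioc_subset_Icc_self hφ⟩
          rw [Real.norm_eq_abs]
          exact abs_le'.mpr ⟨by linarith, by linarith⟩
      _ = 2 * Real.pi * (2 * M) - 2 * Real.pi * (Real.log ‖a θ‖ + quadLog (B θ)) := by
          rw [integral_sub (integrable_const _) hθ.1, integral_const, hθ.2, hμ1, smul_eq_mul]
      _ ≤ _ := by
          have := mul_nonneg hπ.le (quadLog_nonneg (B θ))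
          linarith
  have hint : Integrable (fun θ => quadLog (B θ)) μ := by
    refine ((hFi.integral_prod_left.const_mul (2 * Real.pi)⁻¹).sub hai).congr ?_
    filter_upwards [hsec] with θ hθ
    simp only [Pi.sub_apply]
    rw [hθ.2, inv_mul_cancel_left₀ hπ.ne']
    ring
  refine ⟨(torus_transfer P).1.mpr hFi, hint, ?_⟩
  rw [(torus_transfer P).2, integral_prod _ hFi, integral_congr_ae (hsec.mono fun θ h => h.2),
    integral_const_mul, integral_add hai hint, ha0, zero_add, pow_two,
    mul_inv, mul_assoc, inv_mul_cancel_left₀ hπ.ne']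

theorem integral_log_norm_exp_add_one :
    IntegrableOn (fun θ : ℝ => Real.log ‖Complex.exp (θ * Complex.I) + 1‖) (Ioc 0 (2 * Real.pi)) ∧
      ∫ θ in Ioc 0 (2 * Real.pi), Real.log ‖Complex.exp (θ * Complex.I) + 1‖ = 0 := by
  have hπ : (0 : ℝ) ≤ 2 * Real.pi := by positivity
  have h1 := (Polynomial.X + Polynomial.C 1 : Polynomial ℂ).intervalIntegrable_mahlerMeasure
  have h2 := Polynomial.logMahlerMeasure_X_add_C 1
  rw [Polynomial.logMahlerMeasure_def, Real.circleAverage_def,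
    intervalIntegral.integral_of_le hπ, smul_eq_mul, inv_mul_eq_iff_eq_mul₀ (by positivity)] at h2
  rw [intervalIntegrable_iff_integrableOn_Ioc_of_le hπ] at h1
  simp only [Polynomial.eval_add, Polynomial.eval_X, Polynomial.eval_C, circleMap, zero_add,
    Complex.ofReal_one, one_mul, norm_one, Real.posLog_one, mul_zero] at h1 h2
  exact ⟨h1, h2⟩

theorem logMahler_polyS (α : ℝ) :
    LogIntegrable (polyS α) ∧
      IntegrableOn (fun θ => quadLog ((2 + 2 * Real.cos θ - 2) ^ 2 - 2 +
        (2 + 2 * Real.cos θ) * α)) (Ioc 0 (2 * Real.pi)) ∧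
      logMahler (polyS α) = (2 * Real.pi)⁻¹ * ∫ θ in Ioc 0 (2 * Real.pi),
        quadLog ((2 + 2 * Real.cos θ - 2) ^ 2 - 2 + (2 + 2 * Real.cos θ) * α) := by
  refine logMahler_of_quadratic (a := fun _ => 1)
    (u := fun θ => Complex.exp (θ * Complex.I) ^ 2) (fun θ => ?_) ?_ (by simp) (by simp)
  · rw [norm_pow, Complex.norm_exp_ofReal_mul_I, one_pow]
  · refine Filter.Eventually.of_forall fun θ => ⟨one_ne_zero, fun y => ?_⟩
    have hc := Complex.two_cos (θ : ℂ)
    have hm : Complex.exp (θ * Complex.I) * Complex.exp (-θ * Complex.I) = 1 := by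
      rw [← Complex.exp_add]; simp
    simp only [polyS, map_add, map_mul, map_pow, MvPolynomial.eval_X, MvPolynomial.eval_C, map_one,
      map_ofNat, Matrix.cons_val_zero, Matrix.cons_val_one]
    push_cast
    rw [hc]
    set x := Complex.exp (θ * Complex.I)
    set z := Complex.exp (-θ * Complex.I)
    linear_combination (-(x * z + 1) * y - 2 * x ^ 2 * y - α * x * y) * hm

theorem ae_cos_ne_neg_one : ∀ᵐ θ : ℝ, Real.cos θ ≠ -1 := by
  have h : (range fun k : ℤ => Real.pi + k * (2 * Real.pi)).Countable := countable_range _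
  filter_upwards [h.ae_notMem volume] with θ hθ hc
  exact hθ (Real.cos_eq_neg_one_iff.mp hc)

theorem ae_exp_add_one_ne_zero : ∀ᵐ θ : ℝ ∂volume.restrict (Ioc 0 (2 * Real.pi)),
    Complex.exp (θ * Complex.I) + 1 ≠ 0 := by
  filter_upwards [ae_restrict_of_ae ae_cos_ne_neg_one] with θ hθ h
  apply hθ
  rw [← Complex.exp_ofReal_mul_I_re, eq_neg_of_add_eq_zero_left h]
  simp

theorem logMahler_polyP (α : ℝ) :
    LogIntegrable (polyP α) ∧
      IntegrableOn (fun θ => quadLog (-√(2 + 2 * Real.cos θ) + (√(2 + 2 * Real.cos θ))⁻¹ * α))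
        (Ioc 0 (2 * Real.pi)) ∧
      logMahler (polyP α) = (2 * Real.pi)⁻¹ * ∫ θ in Ioc 0 (2 * Real.pi),
        quadLog (-√(2 + 2 * Real.cos θ) + (√(2 + 2 * Real.cos θ))⁻¹ * α) := by
  -- √(2 + 2 cos θ) = |2 cos(θ/2)|, and the sign is harmless because `quadLog` is even; this form
  -- matches u = exp(iθ/2).
  have hB : ∀ θ : ℝ, quadLog (-√(2 + 2 * Real.cos θ) + (√(2 + 2 * Real.cos θ))⁻¹ * α) =
      quadLog (2 * Real.cos (θ / 2) - (2 * Real.cos (θ / 2))⁻¹ * α) := by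
    intro θ
    have h1 : √(2 + 2 * Real.cos θ) = |2 * Real.cos (θ / 2)| := by
      rw [← Real.sqrt_sq_eq_abs]
      congr 1
      have := Real.cos_sq (θ / 2)
      rw [mul_div_cancel₀ _ (two_ne_zero)] at this
      linear_combination -4 * this
    rw [h1]
    rcases abs_choice (2 * Real.cos (θ / 2)) with h | h <;> rw [h]
    · rw [← quadLog_neg]; congr 1; ring
    · rw [neg_neg, inv_neg]; congr 1; ring
  simp only [hB]
  refine logMahler_of_quadratic (a := fun θ => Complex.exp (θ * Complex.I) + 1)
    (u := fun θ => Complex.exp ((θ / 2 : ℝ) * Complex.I)) (fun θ => ?_) ?_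
    integral_log_norm_exp_add_one.1 integral_log_norm_exp_add_one.2
  · exact Complex.norm_exp_ofReal_mul_I _
  · filter_upwards [ae_exp_add_one_ne_zero] with θ hθ
    refine ⟨hθ, fun y => ?_⟩
    have hc := Complex.two_cos ((θ / 2 : ℝ) : ℂ)
    have hm : Complex.exp ((θ / 2 : ℝ) * Complex.I) *
        Complex.exp (-(θ / 2 : ℝ) * Complex.I) = 1 := by
      rw [← Complex.exp_add]; simp
    have hx : Complex.exp (θ * Complex.I) = Complex.exp ((θ / 2 : ℝ) * Complex.I) ^ 2 := by
      rw [← Complex.exp_nat_mul]; congr 1; push_cast; ring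
    simp only [polyP, map_sub, map_add, map_mul, MvPolynomial.eval_X, MvPolynomial.eval_C, map_one,
      Matrix.cons_val_zero, Matrix.cons_val_one]
    rw [hx] at hθ ⊢
    rw [Complex.ofReal_sub, Complex.ofReal_mul _ α, Complex.ofReal_inv, Complex.ofReal_mul,
      Complex.ofReal_cos, Complex.ofReal_ofNat, hc]
    set v := Complex.exp ((θ / 2 : ℝ) * Complex.I)
    set w := Complex.exp (-(θ / 2 : ℝ) * Complex.I)
    have hv : v ≠ 0 := Complex.exp_ne_zero _
    have hw : w = v⁻¹ := eq_inv_of_mul_eq_one_right hm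
    have hvw : v + v⁻¹ ≠ 0 := by
      intro h
      apply hθ
      field_simp at h
      simpa using h
    rw [hw]
    have hi : (v + v⁻¹)⁻¹ = v / (v ^ 2 + 1) := by
      field_simp
    rw [hi]
    field_simp
    ring

/-! ### Passage to the coordinate s = 2 + 2 cos θ. -/

open Filter Topology

theorem ofReal_mul_arcsineWeight_two_add_two_cos {c d θ : ℝ} (hc : c = 2 * |Real.sin θ|)
    (hd : d = 2 + 2 * Real.cos θ) (h0 : Real.sin θ ≠ 0) (x : ENNReal) :
    ENNReal.ofReal c * (x * arcsineWeight d) = x := by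
  have hpos : 0 < 2 * |Real.sin θ| := by positivity
  have h1 : d * (4 - d) = (2 * |Real.sin θ|) ^ 2 := by
    rw [hd, mul_pow, sq_abs, Real.sin_sq]; ring
  rw [arcsineWeight, h1, Real.sqrt_sq hpos.le, hc, mul_left_comm,
    ← ENNReal.ofReal_mul hpos.le, mul_one_div_cancel hpos.ne', ENNReal.ofReal_one, mul_one]

/-- |ds| = 2 |sin θ| dθ = √(s(4 - s)) dθ, and each s in (0, 4) is hit once on each half of the
circle. -/
theorem lintegral_two_add_two_cos (g : ℝ → ENNReal) :
    ∫⁻ θ in Ioc 0 (2 * Real.pi), g (2 + 2 * Real.cos θ) =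
      2 * ∫⁻ s in Ioo (0 : ℝ) 4, g s * arcsineWeight s := by
  have hπ := Real.pi_pos
  have hd : ∀ θ, HasDerivAt (fun θ => 2 + 2 * Real.cos θ) (2 * -Real.sin θ) θ := fun θ =>
    ((Real.hasDerivAt_cos θ).const_mul 2).const_add 2
  have hneg : ∀ θ ∈ Ioo Real.pi (2 * Real.pi), Real.sin θ < 0 := fun θ hθ => by
    rw [← Real.sin_sub_two_pi]
    exact Real.sin_neg_of_neg_of_neg_pi_lt (by linarith [hθ.2]) (by linarith [hθ.1])
  have h1 := lintegral_comp_of_deriv_neg hπ.le (by fun_prop) (fun θ _ => hd θ)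
    (fun θ hθ => by linarith [Real.sin_pos_of_mem_Ioo hθ]) (fun s => g s * arcsineWeight s)
  have h2 := lintegral_comp_of_deriv_pos (a := Real.pi) (b := 2 * Real.pi) (by linarith)
    (by fun_prop) (fun θ _ => hd θ) (fun θ hθ => by linarith [hneg θ hθ])
    (fun s => g s * arcsineWeight s)
  have e0 : (2 : ℝ) + 2 * -1 = 0 := by norm_num
  have e4 : (2 : ℝ) + 2 * 1 = 4 := by norm_num
  rw [Real.cos_zero, Real.cos_pi, e0, e4] at h1
  rw [Real.cos_two_pi, Real.cos_pi, e0, e4] at h2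
  replace h1 := h1.trans (setLIntegral_congr_fun (g := fun θ => g (2 + 2 * Real.cos θ))
    measurableSet_Ioo fun θ hθ => by
      have := Real.sin_pos_of_mem_Ioo hθ
      exact ofReal_mul_arcsineWeight_two_add_two_cos (by rw [abs_of_pos this]; ring) rfl this.ne' _)
  replace h2 := h2.trans (setLIntegral_congr_fun (g := fun θ => g (2 + 2 * Real.cos θ))
    measurableSet_Ioo fun θ hθ => by
      have := hneg θ hθ
      exact ofReal_mul_arcsineWeight_two_add_two_cos (by rw [abs_of_neg this]) rfl this.ne _)
  rw [← Ioc_union_Ioc_eq_Ioc hπ.le (by linarith : Real.pi ≤ 2 * Real.pi),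
    lintegral_union measurableSet_Ioc (Ioc_disjoint_Ioc_of_le le_rfl),
    ← setLIntegral_congr (Ioo_ae_eq_Ioc (a := 0) (b := Real.pi)),
    ← setLIntegral_congr (Ioo_ae_eq_Ioc (a := Real.pi) (b := 2 * Real.pi)), ← h1, ← h2, two_mul]

/-- Half of the integral of the one-variable Mahler measures of `S_α(x, ·)`, in the coordinate
`s = |x + 1|²`. -/
noncomputable def energyS (α : ℝ) : ENNReal := ∫⁻ s in Ioo (0 : ℝ) 4,
  ENNReal.ofReal (quadLog ((s - 2) ^ 2 - 2 + s * α)) * arcsineWeight s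

/-- Half of the integral of the one-variable Mahler measures of `P_α(x, ·)`, in the coordinate
`s = |x + 1|²`. -/
noncomputable def energyP (α : ℝ) : ENNReal := ∫⁻ s in Ioo (0 : ℝ) 4,
  ENNReal.ofReal (quadLog (-√s + (√s)⁻¹ * α)) * arcsineWeight s

theorem logMahler_eq_toReal {P : MvPolynomial (Fin 2) ℂ} {B : ℝ → ℝ}
    (hi : IntegrableOn (fun θ => quadLog (B (2 + 2 * Real.cos θ))) (Ioc 0 (2 * Real.pi)))
    (hP : logMahler P =
      (2 * Real.pi)⁻¹ * ∫ θ in Ioc 0 (2 * Real.pi), quadLog (B (2 + 2 * Real.cos θ))) :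
    ∫⁻ s in Ioo (0 : ℝ) 4, ENNReal.ofReal (quadLog (B s)) * arcsineWeight s ≠ ⊤ ∧
    logMahler P = Real.pi⁻¹ *
      (∫⁻ s in Ioo (0 : ℝ) 4, ENNReal.ofReal (quadLog (B s)) * arcsineWeight s).toReal := by
  have h0 : 0 ≤ᵐ[volume.restrict (Ioc 0 (2 * Real.pi))]
      fun θ => quadLog (B (2 + 2 * Real.cos θ)) := Eventually.of_forall fun θ => quadLog_nonneg _
  have h := ofReal_integral_eq_lintegral_ofReal hi h0
  rw [lintegral_two_add_two_cos fun s => ENNReal.ofReal (quadLog (B s))] at h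
  refine ⟨fun htop => ?_, ?_⟩
  · rw [htop, ENNReal.mul_top two_ne_zero] at h
    exact ENNReal.ofReal_ne_top h
  · have h' := congrArg ENNReal.toReal h
    rw [ENNReal.toReal_ofReal (integral_nonneg fun θ => quadLog_nonneg _), ENNReal.toReal_mul,
      ENNReal.toReal_ofNat] at h'
    rw [hP, h', mul_inv]
    field_simp

theorem logMahler_polyS_eq_energy (α : ℝ) :
    energyS α ≠ ⊤ ∧ logMahler (polyS α) = Real.pi⁻¹ * (energyS α).toReal :=
  logMahler_eq_toReal (B := fun s => (s - 2) ^ 2 - 2 + s * α)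
    (logMahler_polyS α).2.1 (logMahler_polyS α).2.2

theorem logMahler_polyP_eq_energy (α : ℝ) :
    energyP α ≠ ⊤ ∧ logMahler (polyP α) = Real.pi⁻¹ * (energyP α).toReal :=
  logMahler_eq_toReal (B := fun s => -√s + (√s)⁻¹ * α)
    (logMahler_polyP α).2.1 (logMahler_polyP α).2.2

/-! ### Integrating the kernel identities in α. -/

theorem energyS_eq_two_mul_energyP {α : ℝ} (h0 : 0 ≤ α) (h4 : α ≤ 4) :
    energyS α = 2 * energyP α := by
  have hS := lintegral_quadLog_affine (p := fun s => (s - 2) ^ 2 - 2) (q := fun s => s)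
    (by fun_prop) (by fun_prop) (fun s _ => by nlinarith [sq_nonneg (s - 2)]) (fun s hs => hs.1) h0
  have hP := lintegral_quadLog_affine (p := fun s => -√s) (q := fun s => (√s)⁻¹)
    (by fun_prop) (by fun_prop)
    (fun s hs => neg_le_neg ((Real.sqrt_le_left (by norm_num)).mpr (by linarith [hs.2])))
    (fun s hs => inv_pos.mpr (Real.sqrt_pos.mpr hs.1)) h0
  have hzero : ∀ p : ℝ → ℝ, (∀ s ∈ Ioo (0 : ℝ) 4, |p s| ≤ 2) →
      ∫⁻ s in Ioo (0 : ℝ) 4, ENNReal.ofReal (quadLog (p s)) * arcsineWeight s = 0 := by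
    intro p hp
    rw [setLIntegral_congr_fun (g := fun _ => 0) measurableSet_Ioo fun s hs => by
      simp [quadLog_of_abs_le (hp s hs)], lintegral_zero]
  rw [hzero (fun s => (s - 2) ^ 2 - 2) fun s hs => abs_le.mpr ⟨by nlinarith [sq_nonneg (s - 2)],
    by nlinarith [hs.1, hs.2]⟩, zero_add] at hS
  rw [hzero (fun s => -√s) fun s hs => by
    rw [abs_neg, abs_of_nonneg (Real.sqrt_nonneg _)]
    exact (Real.sqrt_le_left (by norm_num)).mpr (by linarith [hs.2]), zero_add] at hP
  rw [energyS, energyP, hS, hP, ← lintegral_const_mul' _ _ ENNReal.ofNat_ne_top,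
    ← setLIntegral_congr (Ioo_ae_eq_Ioc (a := 0) (b := α)),
    ← setLIntegral_congr (Ioo_ae_eq_Ioc (a := 0) (b := α))]
  exact setLIntegral_congr_fun measurableSet_Ioo fun t ht =>
    kernelS_eq_two_mul_kernelP ht.1 (ht.2.trans_le h4)

/-- Below α = -1 it is -B that grows as α decreases; evenness of `quadLog` allows the sign change,
and -B ≥ -2 already at α = -1. -/
theorem energyS_growth {τ : ℝ} (hτ : 0 ≤ τ) :
    energyS (-1 - τ) = energyS (-1) + ∫⁻ t in Ioc 0 τ, kernelS (-1 - t) := by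
  have h := lintegral_quadLog_affine (p := fun s => -((s - 2) ^ 2 - 2 + s * (-1)))
    (q := fun s => s) (by fun_prop) (by fun_prop)
    (fun s hs => by nlinarith [hs.1, hs.2]) (fun s hs => hs.1) hτ
  have e : ∀ s t : ℝ, -((s - 2) ^ 2 - 2 + s * (-1)) + s * t =
      -((s - 2) ^ 2 - 2 + s * (-1 - t)) := fun s t => by ring
  simp only [e, quadLog_neg, neg_sq] at h
  exact h

theorem energyP_growth {τ : ℝ} (hτ : 0 ≤ τ) :
    energyP (-1 - τ) = energyP (-1) + ∫⁻ t in Ioc 0 τ, kernelP (-1 - t) := by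
  have h := lintegral_quadLog_affine (p := fun s => -(-√s + (√s)⁻¹ * (-1)))
    (q := fun s => (√s)⁻¹) (by fun_prop) (by fun_prop)
    (fun s hs => by
      have := Real.sqrt_nonneg s
      have := inv_nonneg.mpr this
      linarith) (fun s hs => inv_pos.mpr (Real.sqrt_pos.mpr hs.1)) hτ
  have e : ∀ s t : ℝ, -(-√s + (√s)⁻¹ * (-1)) + (√s)⁻¹ * t =
      -(-√s + (√s)⁻¹ * (-1 - t)) := fun s t => by ring
  simp only [e, quadLog_neg, neg_sq] at h
  exact h

theorem logMahler_polyS_sub_polyP_const {α : ℝ} (h : α ≤ -1) :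
    logMahler (polyS α) - logMahler (polyP α) =
      logMahler (polyS (-1)) - logMahler (polyP (-1)) := by
  obtain ⟨τ, hτ, rfl⟩ : ∃ τ : ℝ, 0 ≤ τ ∧ α = -1 - τ := ⟨-1 - α, by linarith, by ring⟩
  have hk : ∫⁻ t in Ioc 0 τ, kernelS (-1 - t) = ∫⁻ t in Ioc 0 τ, kernelP (-1 - t) :=
    setLIntegral_congr_fun measurableSet_Ioc fun t ht => kernelS_eq_kernelP (by linarith [ht.1])
  obtain ⟨s1, s2⟩ := logMahler_polyS_eq_energy (-1 - τ)
  obtain ⟨s3, s4⟩ := logMahler_polyS_eq_energy (-1)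
  obtain ⟨p1, p2⟩ := logMahler_polyP_eq_energy (-1 - τ)
  obtain ⟨p3, p4⟩ := logMahler_polyP_eq_energy (-1)
  rw [energyS_growth hτ] at s1 s2
  rw [energyP_growth hτ, ← hk] at p1 p2
  -- The common increment is finite because the energy at -1 - τ is; only then may it be cancelled.
  have hJ := (ENNReal.add_ne_top.mp s1).2
  rw [s2, s4, p2, p4, ENNReal.toReal_add s3 hJ, ENNReal.toReal_add p3 hJ]
  ring

/-! ### Asymptotics as α → -∞. -/

/-- exp(arcosh m) = m + √(m² - 1) lies between 2m - 1 and 2m. The bound Y/4 serves small Y, where Y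
- 3 has no useful logarithm. -/
theorem exp_quadLog_bounds {X Y : ℝ} (h : |X - Y| ≤ 2) (hY : 0 < Y) :
    Real.exp (quadLog X) ≤ Y + 4 ∧ Y / 4 ≤ Real.exp (quadLog X) ∧
      Y - 3 ≤ Real.exp (quadLog X) := by
  obtain ⟨h1, h2⟩ := abs_le.mp h
  have hX1 : |X| ≤ Y + 2 := abs_le.mpr ⟨by linarith, by linarith⟩
  have hX2 : Y - 2 ≤ |X| := by linarith [le_abs_self X]
  rw [quadLog, Real.exp_arcosh (le_max_left _ _)]
  set m := max 1 (|X| / 2) with hm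
  have hm1 : 1 ≤ m := le_max_left _ _
  have hm2 : |X| / 2 ≤ m := le_max_right _ _
  have hm3 : m ≤ (Y + 2) / 2 := max_le (by linarith) (by linarith)
  have hr1 : √(m ^ 2 - 1) ≤ m := (Real.sqrt_le_left (by linarith)).mpr (by linarith)
  have hr2 : m - 1 ≤ √(m ^ 2 - 1) := Real.le_sqrt_of_sq_le (by nlinarith)
  refine ⟨by linarith, ?_, by linarith⟩
  rcases le_total Y 4 with hY4 | hY4 <;> linarith

theorem tendsto_integral_quadLog {X : ℕ → ℝ → ℝ} {y : ℝ → ℝ}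
    (hX : ∀ n, IntegrableOn (fun θ => quadLog (X n θ)) (Ioc 0 (2 * Real.pi)))
    (hy : ∀ᵐ θ ∂volume.restrict (Ioc 0 (2 * Real.pi)), 0 < y θ)
    (hl : IntegrableOn (fun θ => Real.log (y θ)) (Ioc 0 (2 * Real.pi)))
    (hl0 : ∫ θ in Ioc 0 (2 * Real.pi), Real.log (y θ) = 0)
    (hXY : ∀ᵐ θ ∂volume.restrict (Ioc 0 (2 * Real.pi)), ∀ n : ℕ, |X n θ - (n + 1) * y θ| ≤ 2) :
    Tendsto (fun n : ℕ => (∫ θ in Ioc 0 (2 * Real.pi), quadLog (X n θ)) -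
      2 * Real.pi * Real.log (n + 1)) atTop (𝓝 0) := by
  set μ : Measure ℝ := volume.restrict (Ioc 0 (2 * Real.pi)) with hμ
  have hμ1 : μ.real univ = 2 * Real.pi := by simp [hμ, Measure.real, Real.pi_nonneg]
  have heq : ∀ n : ℕ, (∫ θ, quadLog (X n θ) ∂μ) - 2 * Real.pi * Real.log (n + 1) =
      ∫ θ, (quadLog (X n θ) - (Real.log (n + 1) + Real.log (y θ))) ∂μ := by
    intro n
    have hsum : Integrable (fun θ => Real.log (n + 1) + Real.log (y θ)) μ :=
      (integrable_const _).add hl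
    rw [integral_sub (hX n) hsum, integral_add (integrable_const _) hl,
      hl0, integral_const, hμ1, smul_eq_mul, add_zero]
  simp only [heq]
  rw [← integral_zero ℝ ℝ (μ := μ)]
  -- With Y = (n + 1) y, the upper bound is Y + 4 ≤ 5 exp|log y| Y, as both exp|log y| and exp|log
  -- y| Y are at least 1. Pointwise, `quadLog` is squeezed between log(Y - 3) and log(Y + 4).
  refine tendsto_integral_of_dominated_convergence (fun θ => Real.log 5 + |Real.log (y θ)|)
    (fun n => ((hX n).sub ((integrable_const _).add hl)).aestronglyMeasurable)
    ((integrable_const _).add hl.abs) (fun n => ?_) ?_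
  · filter_upwards [hy, hXY] with θ hyθ h
    have hn : (0 : ℝ) < n + 1 := by positivity
    have hY : 0 < (n + 1) * y θ := mul_pos hn hyθ
    obtain ⟨h1, h2, -⟩ := exp_quadLog_bounds (h n) hY
    rw [← Real.log_mul hn.ne' hyθ.ne', Real.norm_eq_abs, abs_le]
    have hlog4 : Real.log 4 ≤ Real.log 5 := Real.log_le_log (by norm_num) (by norm_num)
    constructor
    · have := Real.log_le_log (by positivity) h2
      rw [Real.log_exp, Real.log_div hY.ne' (by norm_num)] at this
      linarith [abs_nonneg (Real.log (y θ))]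
    · rw [sub_le_iff_le_add, ← Real.exp_le_exp, Real.exp_add, Real.exp_add, Real.exp_log hY,
        Real.exp_log (by norm_num)]
      have e1 : 1 ≤ Real.exp |Real.log (y θ)| := Real.one_le_exp (abs_nonneg _)
      have e2 : 1 ≤ Real.exp |Real.log (y θ)| * y θ := by
        calc 1 = Real.exp (-Real.log (y θ)) * y θ := by
              rw [Real.exp_neg, Real.exp_log hyθ, inv_mul_cancel₀ hyθ.ne']
          _ ≤ _ := mul_le_mul_of_nonneg_right (Real.exp_le_exp.mpr (neg_le_abs _)) hyθ.le
      have e3 : (1 : ℝ) ≤ n + 1 := by linarith [(Nat.cast_nonneg n : (0 : ℝ) ≤ n)]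
      nlinarith
  · filter_upwards [hy, hXY] with θ hyθ h
    have hYt : Tendsto (fun n : ℕ => ((n : ℝ) + 1) * y θ) atTop atTop :=
      (tendsto_atTop_add_const_right _ _ tendsto_natCast_atTop_atTop).atTop_mul_const hyθ
    refine tendsto_of_tendsto_of_tendsto_of_le_of_le'
      ((Real.tendsto_log_comp_add_sub_log (-3)).comp hYt)
      ((Real.tendsto_log_comp_add_sub_log 4).comp hYt) ?_ ?_
    · filter_upwards [hYt.eventually_gt_atTop 3] with n hn3
      have hn : (0 : ℝ) < n + 1 := by positivity
      obtain ⟨-, -, h3⟩ := exp_quadLog_bounds (h n) (mul_pos hn hyθ)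
      have := Real.log_le_log (by linarith) h3
      rw [Real.log_exp] at this
      rw [← Real.log_mul hn.ne' hyθ.ne']
      simp only [Function.comp_apply, ← sub_eq_add_neg]
      linarith
    · refine Eventually.of_forall fun n => ?_
      have hn : (0 : ℝ) < n + 1 := by positivity
      obtain ⟨h1, -, -⟩ := exp_quadLog_bounds (h n) (mul_pos hn hyθ)
      have := Real.log_le_log (Real.exp_pos _) h1
      rw [Real.log_exp] at this
      rw [← Real.log_mul hn.ne' hyθ.ne']
      simp only [Function.comp_apply]
      linarith

theorem integral_log_two_add_two_cos :
    IntegrableOn (fun θ : ℝ => Real.log (2 + 2 * Real.cos θ)) (Ioc 0 (2 * Real.pi)) ∧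
      ∫ θ in Ioc 0 (2 * Real.pi), Real.log (2 + 2 * Real.cos θ) = 0 := by
  have h : ∀ θ : ℝ, Real.log (2 + 2 * Real.cos θ) =
      2 * Real.log ‖Complex.exp (θ * Complex.I) + 1‖ := by
    intro θ
    have : 2 + 2 * Real.cos θ = ‖Complex.exp (θ * Complex.I) + 1‖ ^ 2 := by
      rw [Complex.sq_norm, Complex.normSq_apply]
      simp only [Complex.add_re, Complex.add_im, Complex.exp_ofReal_mul_I_re,
        Complex.exp_ofReal_mul_I_im, Complex.one_re, Complex.one_im]
      linear_combination -Real.sin_sq_add_cos_sq θ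
    rw [this, Real.log_pow]
    norm_num
  simp only [h]
  refine ⟨integral_log_norm_exp_add_one.1.const_mul 2, ?_⟩
  rw [integral_const_mul, integral_log_norm_exp_add_one.2, mul_zero]

theorem ae_two_add_two_cos_pos : ∀ᵐ θ : ℝ ∂volume.restrict (Ioc 0 (2 * Real.pi)),
    0 < 2 + 2 * Real.cos θ := by
  filter_upwards [ae_restrict_of_ae ae_cos_ne_neg_one] with θ hθ
  have := lt_of_le_of_ne (Real.neg_one_le_cos θ) hθ.symm
  linarith

/-- Along α = -1 - n the difference of the measures is constant, while both equal log(n + 1) + o(1):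
the leading coefficients s and 1/√s of -B both have logarithmic mean 0. -/
theorem logMahler_polyS_neg_one : logMahler (polyS (-1)) = logMahler (polyP (-1)) := by
  obtain ⟨hl, hl0⟩ := integral_log_two_add_two_cos
  have hsqrt : ∀ θ : ℝ, Real.log (√(2 + 2 * Real.cos θ))⁻¹ =
      (-1 / 2) * Real.log (2 + 2 * Real.cos θ) := by
    intro θ
    rw [Real.log_inv, Real.log_sqrt (by linarith [Real.neg_one_le_cos θ])]
    ring
  have hS := tendsto_integral_quadLog
    (X := fun n θ => -((2 + 2 * Real.cos θ - 2) ^ 2 - 2 + (2 + 2 * Real.cos θ) * (-1 - n)))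
    (y := fun θ => 2 + 2 * Real.cos θ)
    (fun n => by simp only [quadLog_neg]; exact (logMahler_polyS (-1 - n)).2.1)
    ae_two_add_two_cos_pos hl hl0 (Eventually.of_forall fun θ n => by
      have e : -((2 + 2 * Real.cos θ - 2) ^ 2 - 2 + (2 + 2 * Real.cos θ) * (-1 - n)) -
          (n + 1) * (2 + 2 * Real.cos θ) = 2 - 4 * Real.cos θ ^ 2 := by ring
      rw [e, abs_le]
      constructor <;> nlinarith [Real.cos_sq_le_one θ, sq_nonneg (Real.cos θ)])
  have hP := tendsto_integral_quadLog
    (X := fun n θ => -(-√(2 + 2 * Real.cos θ) + (√(2 + 2 * Real.cos θ))⁻¹ * (-1 - n)))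
    (y := fun θ => (√(2 + 2 * Real.cos θ))⁻¹)
    (fun n => by simp only [quadLog_neg]; exact (logMahler_polyP (-1 - n)).2.1)
    (ae_two_add_two_cos_pos.mono fun θ hθ => inv_pos.mpr (Real.sqrt_pos.mpr hθ))
    (by simp only [hsqrt]; exact hl.const_mul _)
    (by simp only [hsqrt]; rw [integral_const_mul, hl0, mul_zero])
    (Eventually.of_forall fun θ n => by
      have e : -(-√(2 + 2 * Real.cos θ) + (√(2 + 2 * Real.cos θ))⁻¹ * (-1 - n)) -
          (n + 1) * (√(2 + 2 * Real.cos θ))⁻¹ = √(2 + 2 * Real.cos θ) := by ring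
      rw [e, abs_of_nonneg (Real.sqrt_nonneg _)]
      exact (Real.sqrt_le_left (by norm_num)).mpr (by linarith [Real.cos_le_one θ]))
  simp only [quadLog_neg] at hS hP
  have hdiff := (hS.sub hP).const_mul (2 * Real.pi)⁻¹
  rw [sub_zero, mul_zero] at hdiff
  have hconst : ∀ n : ℕ, (2 * Real.pi)⁻¹ *
      ((∫ θ in Ioc 0 (2 * Real.pi), quadLog ((2 + 2 * Real.cos θ - 2) ^ 2 - 2 +
          (2 + 2 * Real.cos θ) * (-1 - n))) - 2 * Real.pi * Real.log (n + 1) -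
        ((∫ θ in Ioc 0 (2 * Real.pi), quadLog (-√(2 + 2 * Real.cos θ) +
          (√(2 + 2 * Real.cos θ))⁻¹ * (-1 - n))) - 2 * Real.pi * Real.log (n + 1))) =
      logMahler (polyS (-1)) - logMahler (polyP (-1)) := by
    intro n
    rw [← logMahler_polyS_sub_polyP_const (α := -1 - n)
      (by linarith [(Nat.cast_nonneg n : (0 : ℝ) ≤ n)]),
      (logMahler_polyS _).2.2, (logMahler_polyP _).2.2]
    ring
  simp only [hconst] at hdiff
  exact sub_eq_zero.mp (tendsto_nhds_unique tendsto_const_nhds hdiff)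

end MahlerFamilies

theorem theorem1p1 (α : ℝ) :
    MahlerFamilies.LogIntegrable (MahlerFamilies.polyP α) ∧
    MahlerFamilies.LogIntegrable (MahlerFamilies.polyS α) ∧
    (0 ≤ α → α ≤ 4 →
      MahlerFamilies.logMahler (MahlerFamilies.polyS α) =
        2 * MahlerFamilies.logMahler (MahlerFamilies.polyP α)) ∧
    (α ≤ -1 →
      MahlerFamilies.logMahler (MahlerFamilies.polyS α) =
        MahlerFamilies.logMahler (MahlerFamilies.polyP α)) := by
  refine ⟨(MahlerFamilies.logMahler_polyP α).1, (MahlerFamilies.logMahler_polyS α).1,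
    fun h0 h4 => ?_, fun h => ?_⟩
  · rw [(MahlerFamilies.logMahler_polyS_eq_energy α).2,
      (MahlerFamilies.logMahler_polyP_eq_energy α).2,
      MahlerFamilies.energyS_eq_two_mul_energyP h0 h4, ENNReal.toReal_mul, ENNReal.toReal_ofNat]
    ring
  · have := MahlerFamilies.logMahler_polyS_sub_polyP_const h
    rw [MahlerFamilies.logMahler_polyS_neg_one, sub_self] at this
    exact sub_eq_zero.mp this
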